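/- A continued fraction $(a_n,b_n)_{n\ge 0}$ is given by rational numbers $a_n,b_n$ with $b_n\ne 0$ for all $n$ and $a_n\neq 0$ for all but finitely many $n$, and has convergents $p_n/q_n=a_0+b_0/(a_1+b_1/(a_2+\cdots+b_{n-1}/a_n))$. It converges to $z$ if $q_n\neq 0$ for all sufficiently large $n$ and $p_n/q_n\to z$. A pair of polynomials $(A,B)$ with rational coefficients represents $z$ if some continued fraction $(a_n,b_n)_{n\ge0}$ with $a_n=A(n)$ and $b_n=B(n)$ for all sufficiently large $n$ converges to $z$. Let $u,v,w,k$ be nonnegative integers and put \begin{align*} A(n)&=(2n+2(u+v+w)-1)\bigl(n^2+(2(u+v+w)-1)n+u^2+2v^2+4w^2+3uv+4uw+6vw\\ &\qquad+v+2w+1+2k(u+2v+3w)+2k^2+2k\bigr),\\ B(n)&=-n(n+u)(n+u+v)(n+u+v+2w)(n+u+2v+2w)(n+2u+2v+2w). \end{align*} Then $(A,B)$ represents $\zeta(3)$. Moreover, for every continued fraction $(a_n,b_n)_{n\ge0}$ that converges to $\zeta(3)$ and satisfies $a_n=A(n)$, $b_n=B(n)$ for all sufficiently large $n$, there is a constant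 $C\neq 0$ with $$\zeta(3)-\frac{p_n}{q_n}\sim\frac{C}{n^{2u+4v+6w+4k+2}}\qquad(n\to\infty).$$ -/

import Mathlib

open Polynomial Filter Topology

/-- The generalized continued fraction `a 0 + b 0 / (a 1 + b 1 / (a 2 + b 2 / (a 3 + ⋯)))`.
Its `n`-th numerator and denominator are the `p n` and `q n` with
`p n / q n = a 0 + b 0 / (a 1 + ⋯ + b (n - 1) / a n)`. -/
def ratCF (a b : ℕ → ℚ) : GenContFract ℚ where
  h := a 0
  s := Stream'.Seq.ofStream fun n => ⟨b n, a (n + 1)⟩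

theorem ratCF_get? (a b : ℕ → ℚ) (n : ℕ) :
    (ratCF a b).s.get? n = some ⟨b n, a (n + 1)⟩ := rfl

/-- The continued fraction `(a, b)` is admissible and agrees with the pair of polynomials `(A, B)`
for all sufficiently large indices: no `b n` vanishes, and at most finitely many `a n` do. -/
structure HasPolynomialTail (a b : ℕ → ℚ) (A B : ℚ[X]) : Prop where
  b_ne_zero : ∀ n, b n ≠ 0
  a_ne_zero : ∀ᶠ n in atTop, a n ≠ 0
  a_eq : ∀ᶠ n : ℕ in atTop, a n = A.eval (n : ℚ)
  b_eq : ∀ᶠ n : ℕ in atTop, b n = B.eval (n : ℚ)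

/-- The continued fraction `(a, b)` converges to `z`: the convergents `p n / q n` are defined for
all sufficiently large `n`, and they tend to `z`. -/
def CFConvergesTo (a b : ℕ → ℚ) (z : ℂ) : Prop :=
  (∀ᶠ n in atTop, (ratCF a b).dens n ≠ 0) ∧
    Tendsto (fun n => (((ratCF a b).convs n : ℚ) : ℂ)) atTop (𝓝 z)

/-- `z - p n / q n` is asymptotically equal to `C / n ^ P` for some nonzero constant `C`. -/
def CFHasSpeed (a b : ℕ → ℚ) (z : ℂ) (P : ℕ) : Prop :=
  ∃ C : ℂ, C ≠ 0 ∧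
    Tendsto (fun n : ℕ => (n : ℂ) ^ P * (z - (((ratCF a b).convs n : ℚ) : ℂ))) atTop (𝓝 C)

/-- The pair of rational polynomials `(A, B)` represents `z`: some continued fraction that
agrees with `(A, B)` for all sufficiently large indices converges to `z`. -/
def Represents (A B : ℚ[X]) (z : ℂ) : Prop :=
  ∃ a b : ℕ → ℚ, HasPolynomialTail a b A B ∧ CFConvergesTo a b z

/-- The polynomial `A` of the four-parameter family. -/
noncomputable def familyA (u v w k : ℕ) : ℚ[X] :=
  (2 * X + C (2 * ((u : ℚ) + v + w) - 1)) *
    (X ^ 2 + C (2 * ((u : ℚ) + v + w) - 1) * X +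
      C ((u : ℚ) ^ 2 + 2 * v ^ 2 + 4 * w ^ 2 + 3 * u * v + 4 * u * w + 6 * v * w + v + 2 * w + 1
        + 2 * k * (u + 2 * v + 3 * w) + 2 * k ^ 2 + 2 * k))

/-- The polynomial `B` of the four-parameter family. -/
noncomputable def familyB (u v w : ℕ) : ℚ[X] :=
  -(X * (X + C (u : ℚ)) * (X + C ((u : ℚ) + v)) * (X + C ((u : ℚ) + v + 2 * w)) *
    (X + C ((u : ℚ) + 2 * v + 2 * w)) * (X + C (2 * (u : ℚ) + 2 * v + 2 * w)))

/-! After the shift `m = n + u + v + w` and division by `gaugeProd`, the numerators and denominators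
of the continued fraction eventually satisfy the recurrence `recur`, symmetric in its parameters `x
= w`, `y = v + w`, `t = u + v + w`. Write σ = x + y + t = u + 2v + 3w.

Speed: the recurrence has a polynomial solution Y (`domSol`) of degree 2k. The Casoratian of any
solution with Y is eventually a constant divided by a polynomial of degree 2σ + 3, so reduction of
order writes every solution as Y (L + C τ) with τ ~ c / n^(2σ+4k+2), c ≠ 0 (`exists_tail`). If two
independent solutions have a quotient tending to ζ, the error is therefore asymptotic to a nonzero
multiple of τ. Also, every solution that tends to zero is O(n^-(2σ+2k+2)).

Limit: for x = y = t = k = 0 the constant 1 and the partial sums of ∑ 1/i³ are solutions. The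
operator `raise` carries solutions for x to solutions for x + 1 and multiplies the Casoratian by an
explicit nonzero factor. It costs one power of n, which the fast decay of P - ζ Q can afford.
Symmetry raises y and t, and a detour through x = 1 and x = -1 raises k (`reaches`). The resulting P
and Q are turned back into a continued fraction by `exists_ratCF_eventually`. -/

/-! ### The normalized recurrence and its contiguity operator -/

section Algebra

variable {F : Type*} [Field F]

/-- The constant of the middle coefficient of the normalized recurrence. -/
def midConst (x y t k : F) : F :=
  x * y + y * t + x * t + (2 * k + 1) * (x + y + t) + 2 * k ^ 2 + 2 * k + 1

/-- The left side of the normalized recurrence between three consecutive values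
`f₀ = f m`, `f₁ = f (m + 1)`, `f₂ = f (m + 2)`. -/
def recur (x y t k m f₀ f₁ f₂ : F) : F :=
  (m + 2 + x) * (m + 2 + y) * (m + 2 + t) * f₂
    - (2 * m + 3) * ((m + 1) * (m + 2) + midConst x y t k) * f₁
    + (m + 1 - x) * (m + 1 - y) * (m + 1 - t) * f₀

/-- `f` eventually satisfies the normalized recurrence with parameters `x, y, t, k`. -/
def IsSol (x y t k : F) (f : ℕ → F) : Prop :=
  ∀ᶠ n : ℕ in atTop, recur x y t k (n : F) (f n) (f (n + 1)) (f (n + 2)) = 0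

/-- The Casoratian of two sequences. -/
def casoratian (f g : ℕ → F) (n : ℕ) : F := f n * g (n + 1) - f (n + 1) * g n

/-- The numerator of the contiguity operator. -/
def raiseNum (x y t k m f₀ f₁ : F) : F :=
  (m + 1 + y) * (m + 1 + t) * f₁
    - (m * (m + 1) + midConst x y t k - (2 * k + 1 + 2 * x + y + t) * (m - x)) * f₀

/-- The contiguity operator, which raises the parameter `x` by one. -/
def raise (x y t k : F) (f : ℕ → F) (n : ℕ) : F :=
  raiseNum x y t k n (f n) (f (n + 1)) / ((n : F) - x)

theorem IsSol.swap₁₂ {x y t k : F} {f : ℕ → F} (h : IsSol x y t k f) : IsSol y x t k f := by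
  filter_upwards [h] with n hn
  rw [← hn]; simp only [recur, midConst]; ring

theorem IsSol.swap₁₃ {x y t k : F} {f : ℕ → F} (h : IsSol x y t k f) : IsSol t y x k f := by
  filter_upwards [h] with n hn
  rw [← hn]; simp only [recur, midConst]; ring

theorem IsSol.sub_const_mul {x y t k : F} {f g : ℕ → F} (hf : IsSol x y t k f)
    (hg : IsSol x y t k g) (c : F) : IsSol x y t k (fun n => f n - c * g n) := by
  filter_upwards [hf, hg] with n h1 h2
  simp only [recur] at *
  linear_combination h1 - c * h2

theorem IsSol.map {E : Type*} [Field E] (φ : F →+* E) {x y t k : F} {f : ℕ → F}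
    (hf : IsSol x y t k f) : IsSol (φ x) (φ y) (φ t) (φ k) (fun n => φ (f n)) := by
  filter_upwards [hf] with n h
  have := congrArg φ h
  simpa [recur, midConst, map_ofNat] using this

/-- The value of `raise` at the next index, rewritten by means of the recurrence. -/
theorem mul_raiseNum_succ {x y t k m f₀ f₁ f₂ : F} (h : recur x y t k m f₀ f₁ f₂ = 0) :
    (m + 2 + x) * raiseNum x y t k (m + 1) f₁ f₂ = (m + 1 - x) *
      (((m + 1) * (m + 2) + midConst x y t k + (2 * k + 1 + 2 * x + y + t) * (m + 2 + x)) * f₁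
        - (m + 1 - y) * (m + 1 - t) * f₀) := by
  simp only [recur, raiseNum, midConst] at *
  linear_combination h

theorem mul_raise {x y t k : F} (f : ℕ → F) {n : ℕ} (h : (n : F) - x ≠ 0) :
    ((n : F) - x) * raise x y t k f n = raiseNum x y t k n (f n) (f (n + 1)) :=
  mul_div_cancel₀ _ h

/-- The recurrence trades the denominator `n + 1 - x` for `n + 2 + x` and eliminates `f (n + 2)`, so
two consecutive values of `raise` become combinations of `f n` and `f (n + 1)` alone. -/
theorem mul_raise_succ {x y t k : F} {f : ℕ → F} {n : ℕ}
    (hf : recur x y t k (n : F) (f n) (f (n + 1)) (f (n + 2)) = 0) (h : (n : F) + 1 - x ≠ 0) :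
    ((n : F) + 2 + x) * raise x y t k f (n + 1) =
      (((n : F) + 1) * (n + 2) + midConst x y t k + (2 * k + 1 + 2 * x + y + t) * (n + 2 + x))
        * f (n + 1) - ((n : F) + 1 - y) * (n + 1 - t) * f n := by
  simp only [raise]
  push_cast
  rw [← mul_div_assoc]
  exact (congrArg (· / ((n : F) + 1 - x)) (mul_raiseNum_succ hf)).trans
    (mul_div_cancel_left₀ _ h)

theorem isSol_raise {x y t k : F} {f : ℕ → F} (hf : IsSol x y t k f)
    (hx : ∀ᶠ n : ℕ in atTop, (n : F) - x ≠ 0) :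
    IsSol (x + 1) y t k (raise x y t k f) := by
  have hx1 := (tendsto_add_atTop_nat 1).eventually hx
  have hx2 := (tendsto_add_atTop_nat 2).eventually hx
  have hf1 := (tendsto_add_atTop_nat 1).eventually hf
  filter_upwards [hf, hf1, hx, hx1, hx2] with n h0 h1 n0 n1 n2
  have e : ((n + 1 : ℕ) : F) + 1 - x = ((n + 2 : ℕ) : F) - x := by push_cast; ring
  have k2 := mul_raise_succ h1 (by rw [e]; exact n2)
  have k1 := mul_raise (y := y) (t := t) (k := k) f n1
  have k0 := mul_raise (y := y) (t := t) (k := k) f n0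
  simp only [add_assoc, Nat.reduceAdd] at *
  push_cast at *
  -- The outer coefficients for `x + 1` contain `n + 3 + x` and `n - x`, which clear the
  -- denominators in `k2` and `k0`. Only the middle value still needs the factor `n + 1 - x`. What
  -- remains is a multiple of the recurrence `h0`.
  apply mul_left_cancel₀ n1
  simp only [recur, raiseNum, midConst] at *
  linear_combination (n + 1 - x) * (n + 2 + y) * (n + 2 + t) * k2
    - (2 * n + 3) * ((n + 1) * (n + 2) + (x + 1) * y + y * t + (x + 1) * t
      + (2 * k + 1) * (x + 1 + y + t) + 2 * k ^ 2 + 2 * k + 1) * k1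
    + (n + 1 - x) * (n + 1 - y) * (n + 1 - t) * k0
    - (n * (n + 1) + (x * y + y * t + x * t + (2 * k + 1) * (x + y + t) + 2 * k ^ 2 + 2 * k + 1)
      - (2 * k + 1 + 2 * x + y + t) * (n - x)) * h0

/-- The right-hand factor is the determinant of the linear map from `(f n, f (n + 1))` to two
consecutive values of `raise`, cleared of denominators. It does not depend on `n`, so independence
survives as soon as it is nonzero. -/
theorem casoratian_raise {x y t k : F} {f g : ℕ → F} {n : ℕ}
    (hf : recur x y t k (n : F) (f n) (f (n + 1)) (f (n + 2)) = 0)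
    (hg : recur x y t k (n : F) (g n) (g (n + 1)) (g (n + 2)) = 0)
    (h0 : (n : F) - x ≠ 0) (h1 : (n : F) + 1 - x ≠ 0) :
    ((n : F) - x) * (n + 2 + x) * casoratian (raise x y t k f) (raise x y t k g) n =
      -4 * (k + 1 + x) * (k + 1 + x + y) * (k + 1 + x + t) * (k + 1 + x + y + t)
        * casoratian f g n := by
  have kf := mul_raise_succ hf h1
  have kg := mul_raise_succ hg h1
  have kf0 := mul_raise (y := y) (t := t) (k := k) f h0
  have kg0 := mul_raise (y := y) (t := t) (k := k) g h0
  simp only [casoratian]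
  set F1 := raise x y t k f (n + 1)
  set G1 := raise x y t k g (n + 1)
  set F0 := raise x y t k f n
  set G0 := raise x y t k g n
  have : ((n : F) - x) * (n + 2 + x) * (F0 * G1 - F1 * G0) =
      ((n - x) * F0) * ((n + 2 + x) * G1) - ((n + 2 + x) * F1) * ((n - x) * G0) := by ring
  rw [this, kf, kg, kf0, kg0]
  simp only [raiseNum, midConst]
  ring

/-- Multiplication by `m (m + 1)` reflects the parameter `1` to `-1`. -/
theorem IsSol.reflect {k : F} {f : ℕ → F} (h : IsSol 1 0 0 k f) :
    IsSol (-1) 0 0 (k + 1) (fun n => (n : F) * (n + 1) * f n) := by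
  filter_upwards [h] with n hn
  simp only [recur, midConst] at *
  push_cast
  linear_combination ((n : F) + 1) * (n + 2) * hn

end Algebra

/-! ### The polynomial solution -/

section Dominant

/-- The basis function `∏_{i < j} (m - x - i) (m + x + 1 + i)`. -/
noncomputable def basisFun (x : ℝ) (j : ℕ) (m : ℝ) : ℝ :=
  ∏ i ∈ Finset.range j, ((m - x - i) * (m + x + 1 + i))

theorem basisFun_succ (x : ℝ) (j : ℕ) (m : ℝ) :
    basisFun x (j + 1) m = basisFun x j m * ((m - x - j) * (m + x + 1 + j)) :=
  Finset.prod_range_succ _ _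

/-- Shifting moves each linear factor onto its neighbour, so all but a few factors cancel. With
`basisFun_sub_one`, this expresses the recurrence through basis functions at the central point only.
-/
theorem basisFun_add_one (x : ℝ) (j : ℕ) (m : ℝ) :
    (m + 1 + x) * basisFun x (j + 1) (m + 1) =
      (m + 1 - x) * (m + x + 1 + j) * (m + x + 2 + j) * basisFun x j m := by
  induction j with
  | zero => simp [basisFun]; ring
  | succ j ih =>
    rw [basisFun_succ, ← mul_assoc, ih, basisFun_succ]
    push_cast
    ring

theorem basisFun_sub_one (x : ℝ) (j : ℕ) (m : ℝ) :
    (m - x) * basisFun x (j + 1) (m - 1) =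
      (m + x) * (m - x - j) * (m - x - j - 1) * basisFun x j m := by
  induction j with
  | zero => simp [basisFun]; ring
  | succ j ih =>
    rw [basisFun_succ, ← mul_assoc, ih, basisFun_succ]
    push_cast
    ring

/-- The difference operator of the normalized recurrence, centred at `m + 1`. -/
theorem recur_basisFun_succ (x y t k m : ℝ) (j : ℕ) :
    recur x y t k m (basisFun x (j + 1) m) (basisFun x (j + 1) (m + 1))
        (basisFun x (j + 1) (m + 2)) =
      (2 * m + 3) * (2 * ((j + 1) * (j + 1 + x + y + t + 1) - k * (k + x + y + t + 1))
          * basisFun x (j + 1) (m + 1)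
        + 2 * (j + 1) * (x + j + 1) * (x + j + 1 + y) * (x + j + 1 + t)
          * basisFun x j (m + 1)) := by
  have h1 := basisFun_add_one x j (m + 1)
  have h2 := basisFun_sub_one x j (m + 1)
  rw [show m + 1 + 1 = m + 2 by ring] at h1
  rw [show m + 1 - 1 = m by ring] at h2
  rw [basisFun_succ x j (m + 1)]
  simp only [recur, midConst]
  linear_combination (m + 2 + y) * (m + 2 + t) * h1 + (m + 1 - y) * (m + 1 - t) * h2

theorem recur_basisFun_zero (x y t k m : ℝ) :
    recur x y t k m (basisFun x 0 m) (basisFun x 0 (m + 1)) (basisFun x 0 (m + 2)) =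
      (2 * m + 3) * (2 * (- k * (k + x + y + t + 1)) * basisFun x 0 (m + 1)) := by
  simp only [basisFun, Finset.range_zero, Finset.prod_empty, recur, midConst]
  ring

/-- The coefficients of the polynomial solution in the basis `basisFun x`. -/
noncomputable def domCoeff (x y t k : ℝ) : ℕ → ℝ
  | 0 => 1
  | j + 1 => domCoeff x y t k j * (k * (k + x + y + t + 1) - j * (j + x + y + t + 1)) /
      ((j + 1) * (x + j + 1) * (x + j + 1 + y) * (x + j + 1 + t))

/-- The polynomial solution of the normalized recurrence. -/
noncomputable def domSol (x y t : ℝ) (k : ℕ) (m : ℝ) : ℝ :=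
  ∑ j ∈ Finset.range (k + 1), domCoeff x y t k j * basisFun x j m

theorem recur_sum (x y t k m : ℝ) (N : ℕ) (c f₀ f₁ f₂ : ℕ → ℝ) :
    recur x y t k m (∑ j ∈ Finset.range N, c j * f₀ j) (∑ j ∈ Finset.range N, c j * f₁ j)
      (∑ j ∈ Finset.range N, c j * f₂ j)
      = ∑ j ∈ Finset.range N, c j * recur x y t k m (f₀ j) (f₁ j) (f₂ j) := by
  simp only [recur, Finset.mul_sum, ← Finset.sum_sub_distrib, ← Finset.sum_add_distrib]
  exact Finset.sum_congr rfl fun j _ => by ring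

/-- The sum telescopes: `domCoeff` is chosen so that the lower term produced by index `N + 1`
cancels the remainder left at `N`. The last remainder has a factor that vanishes at `N = k`, which
is why the solution is a finite sum. -/
theorem recur_domSol_partial {x y t : ℝ} (hx : 0 ≤ x) (hy : 0 ≤ y) (ht : 0 ≤ t) (k m : ℝ)
    (N : ℕ) :
    ∑ j ∈ Finset.range (N + 1), domCoeff x y t k j *
        recur x y t k m (basisFun x j m) (basisFun x j (m + 1)) (basisFun x j (m + 2)) =
      (2 * m + 3) * (2 * (N * (N + x + y + t + 1) - k * (k + x + y + t + 1)) *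
        (domCoeff x y t k N * basisFun x N (m + 1))) := by
  induction N with
  | zero => simp [domCoeff, recur_basisFun_zero]
  | succ N ih =>
    rw [Finset.sum_range_succ, ih, recur_basisFun_succ]
    have hN : (0 : ℝ) ≤ N := N.cast_nonneg
    have h : domCoeff x y t k (N + 1) * (((N : ℝ) + 1) * (x + N + 1) * (x + N + 1 + y)
        * (x + N + 1 + t)) =
        domCoeff x y t k N * (k * (k + x + y + t + 1) - N * (N + x + y + t + 1)) := by
      rw [domCoeff]
      exact div_mul_cancel₀ _ (by positivity)
    push_cast
    linear_combination (2 * m + 3) * 2 * basisFun x N (m + 1) * h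

theorem recur_domSol {x y t : ℝ} (hx : 0 ≤ x) (hy : 0 ≤ y) (ht : 0 ≤ t) (k : ℕ) (m : ℝ) :
    recur x y t k m (domSol x y t k m) (domSol x y t k (m + 1)) (domSol x y t k (m + 2)) = 0 := by
  simp only [domSol]
  rw [recur_sum, recur_domSol_partial hx hy ht]
  ring

theorem domCoeff_ne_zero {x y t : ℝ} (hx : 0 ≤ x) (hy : 0 ≤ y) (ht : 0 ≤ t) {k j : ℕ}
    (hj : j ≤ k) : domCoeff x y t k j ≠ 0 := by
  induction j with
  | zero => simp [domCoeff]
  | succ j ih =>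
    have h1 : (j : ℝ) + 1 ≤ k := by exact_mod_cast hj
    have h0 : (0 : ℝ) ≤ j := j.cast_nonneg
    rw [domCoeff]
    refine div_ne_zero (mul_ne_zero (ih (by omega)) ?_) (by positivity)
    have : (k : ℝ) * (k + x + y + t + 1) - j * (j + x + y + t + 1) =
      (k - j) * (k + j + x + y + t + 1) := by ring
    rw [this]
    have h2 : (0 : ℝ) < k - j := by linarith
    positivity

theorem tendsto_add_div_natCast (a : ℝ) :
    Tendsto (fun n : ℕ => ((n : ℝ) + a) / n) atTop (𝓝 1) := by
  have h : Tendsto (fun n : ℕ => 1 + a / (n : ℝ)) atTop (𝓝 (1 + 0)) :=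
    tendsto_const_nhds.add (tendsto_const_div_atTop_nhds_zero_nat a)
  rw [add_zero] at h
  refine h.congr' ?_
  filter_upwards [eventually_ne_atTop 0] with n hn
  field_simp

theorem tendsto_basisFun_div (x : ℝ) (j : ℕ) :
    Tendsto (fun n : ℕ => basisFun x j n / (n : ℝ) ^ (2 * j)) atTop (𝓝 1) := by
  induction j with
  | zero => simp [basisFun]
  | succ j ih =>
    have h := ih.mul ((tendsto_add_div_natCast (-x - j)).mul (tendsto_add_div_natCast (x + 1 + j)))
    simp only [mul_one] at h
    refine h.congr fun n => ?_
    rw [basisFun_succ, show 2 * (j + 1) = 2 * j + 2 by ring, pow_add]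
    by_cases hn : (n : ℝ) = 0
    · simp [hn]
    · field_simp
      ring

theorem tendsto_pow_div_pow {i j : ℕ} (h : i < j) :
    Tendsto (fun n : ℕ => (n : ℝ) ^ i / (n : ℝ) ^ j) atTop (𝓝 0) :=
  (tendsto_pow_div_pow_atTop_zero h).comp tendsto_natCast_atTop_atTop

theorem tendsto_domSol_div (x y t : ℝ) (k : ℕ) :
    Tendsto (fun n : ℕ => domSol x y t k n / (n : ℝ) ^ (2 * k)) atTop
      (𝓝 (domCoeff x y t k k)) := by
  have h : ∀ j ∈ Finset.range k, Tendsto (fun n : ℕ =>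
      domCoeff x y t k j * basisFun x j n / (n : ℝ) ^ (2 * k)) atTop (𝓝 0) := by
    intro j hj
    have h1 := ((tendsto_basisFun_div x j).mul
      (tendsto_pow_div_pow (show 2 * j < 2 * k by have := Finset.mem_range.1 hj; omega))).const_mul
      (domCoeff x y t k j)
    simp only [mul_zero] at h1
    refine h1.congr' ?_
    filter_upwards [eventually_ne_atTop 0] with n hn
    field_simp
  have h2 := (tendsto_finsetSum _ h).add ((tendsto_basisFun_div x k).const_mul
    (domCoeff x y t k k))
  simp only [Finset.sum_const_zero, zero_add, mul_one] at h2
  refine h2.congr fun n => ?_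
  rw [domSol, Finset.sum_range_succ, add_div, Finset.sum_div, mul_div_assoc]

end Dominant

/-! ### Tail asymptotics and reduction of order -/

section Tails

theorem nonneg_of_antitone_tendsto_zero {u : ℕ → ℝ} {N : ℕ} (h : ∀ n ≥ N, u (n + 1) ≤ u n)
    (h0 : Tendsto u atTop (𝓝 0)) : ∀ n ≥ N, 0 ≤ u n := by
  intro n hn
  have anti : Antitone fun i => u (i + n) :=
    antitone_nat_of_succ_le fun i => by
      have := h (i + n) (by omega)
      rwa [show i + 1 + n = i + n + 1 by ring]
  simpa using anti.le_of_tendsto ((tendsto_add_atTop_iff_nat n).2 h0) 0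

/-- The Stolz–Cesàro theorem for null sequences. -/
theorem tendsto_div_of_tendsto_sub_div_sub {a b : ℕ → ℝ} {l : ℝ} (ha : Tendsto a atTop (𝓝 0))
    (hb : Tendsto b atTop (𝓝 0)) (hb' : ∀ᶠ n in atTop, b (n + 1) < b n)
    (h : Tendsto (fun n => (a n - a (n + 1)) / (b n - b (n + 1))) atTop (𝓝 l)) :
    Tendsto (fun n => a n / b n) atTop (𝓝 l) := by
  have bpos : ∀ᶠ n in atTop, 0 < b n := by
    obtain ⟨N, hN⟩ := eventually_atTop.1 hb'
    filter_upwards [eventually_ge_atTop N] with n hn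
    exact (nonneg_of_antitone_tendsto_zero (fun m hm => (hN m hm).le) hb (n + 1)
      (by omega)).trans_lt (hN n hn)
  rw [Metric.tendsto_atTop'] at h
  rw [Metric.tendsto_nhds]
  intro ε hε
  obtain ⟨N₁, h₁⟩ := h (ε / 2) (half_pos hε)
  obtain ⟨N₂, h₂⟩ := eventually_atTop.1 hb'
  set N := max (N₁ + 1) N₂
  have step : ∀ n ≥ N, |a n - a (n + 1) - l * (b n - b (n + 1))| ≤ ε / 2 * (b n - b (n + 1)) := by
    intro n hn
    have hd : 0 < b n - b (n + 1) := sub_pos.2 (h₂ n (le_trans (le_max_right _ _) hn))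
    have := (h₁ n (lt_of_lt_of_le (Nat.lt_succ_self _) (le_trans (le_max_left _ _) hn))).le
    rw [Real.dist_eq] at this
    calc |a n - a (n + 1) - l * (b n - b (n + 1))|
        = |((a n - a (n + 1)) / (b n - b (n + 1)) - l) * (b n - b (n + 1))| := by
          congr 1; field_simp
      _ ≤ _ := by rw [abs_mul, abs_of_pos hd]; gcongr
  -- By `step`, both `(l + ε / 2) b - a` and `a - (l - ε / 2) b` eventually decrease to zero, hence
  -- are nonnegative.
  have up := nonneg_of_antitone_tendsto_zero (u := fun n => (l + ε / 2) * b n - a n) (N := N)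
    (fun n hn => by have := (abs_le.1 (step n hn)).2; linarith)
    (by simpa using (hb.const_mul (l + ε / 2)).sub ha)
  have lo := nonneg_of_antitone_tendsto_zero (u := fun n => a n - (l - ε / 2) * b n) (N := N)
    (fun n hn => by have := (abs_le.1 (step n hn)).1; linarith)
    (by simpa using ha.sub (hb.const_mul (l - ε / 2)))
  filter_upwards [bpos, eventually_ge_atTop N] with n hn hN
  have u1 := up n hN
  have u2 := lo n hN
  rw [Real.dist_eq, abs_lt, lt_sub_iff_add_lt, sub_lt_iff_lt_add, lt_div_iff₀ hn, div_lt_iff₀ hn]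
  constructor <;> nlinarith

/-- With r = n / (n + 1), the factorization 1 - r^P = (1 - r)(1 + r + ⋯ + r^(P-1)) leaves `P` terms,
each tending to 1. -/
theorem tendsto_mul_sub_inv_pow (P : ℕ) :
    Tendsto (fun n : ℕ => (n : ℝ) ^ (P + 1) * (1 / (n : ℝ) ^ P - 1 / ((n : ℝ) + 1) ^ P))
      atTop (𝓝 P) := by
  have hr : Tendsto (fun n : ℕ => (n : ℝ) / (n + 1)) atTop (𝓝 1) := by
    have := (tendsto_add_div_natCast 1).inv₀ one_ne_zero
    simpa using this
  have h := hr.mul (tendsto_finsetSum (Finset.range P) fun i _ => hr.pow i)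
  simp only [one_pow, Finset.sum_const, Finset.card_range, nsmul_eq_mul, mul_one, one_mul] at h
  refine h.congr' ?_
  filter_upwards [eventually_ne_atTop 0] with n hn
  have hn' : (n : ℝ) ≠ 0 := by exact_mod_cast hn
  have hn1 : (n : ℝ) + 1 ≠ 0 := by positivity
  have g := mul_neg_geom_sum ((n : ℝ) / (n + 1)) P
  have e : 1 - (n : ℝ) / (n + 1) = 1 / (n + 1) := by field_simp; ring
  rw [e] at g
  calc (n : ℝ) / (n + 1) * ∑ i ∈ Finset.range P, ((n : ℝ) / (n + 1)) ^ i
      = n * (1 / ((n : ℝ) + 1) * ∑ i ∈ Finset.range P, ((n : ℝ) / (n + 1)) ^ i) := by ring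
    _ = _ := by rw [g, div_pow]; field_simp; ring

theorem exists_tail_of_tendsto {d : ℕ → ℝ} {P : ℕ} {δ : ℝ} (hP : P ≠ 0)
    (hd : Tendsto (fun n : ℕ => (n : ℝ) ^ (P + 1) * d n) atTop (𝓝 δ)) :
    ∃ τ : ℕ → ℝ, (∀ n, τ n - τ (n + 1) = d n) ∧
      Tendsto (fun n : ℕ => (n : ℝ) ^ P * τ n) atTop (𝓝 (δ / P)) := by
  have hs : Summable d := by
    refine summable_of_isBigO_nat (Real.summable_one_div_nat_pow.2 (show 1 < P + 1 by omega)) ?_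
    have h1 := (hd.isBigO_one ℝ).mul
      (Asymptotics.isBigO_refl (fun n : ℕ => 1 / (n : ℝ) ^ (P + 1)) atTop)
    simp only [one_mul] at h1
    refine h1.congr' ?_ EventuallyEq.rfl
    filter_upwards [eventually_ne_atTop 0] with n hn
    field_simp
  refine ⟨fun n => (∑' i, d i) - ∑ i ∈ Finset.range n, d i, fun n => ?_, ?_⟩
  · simp only [Finset.sum_range_succ]; ring
  set τ : ℕ → ℝ := fun n => (∑' i, d i) - ∑ i ∈ Finset.range n, d i with hτ
  have hτd : ∀ n, τ n - τ (n + 1) = d n := fun n => by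
    simp only [hτ, Finset.sum_range_succ]; ring
  have hτ0 : Tendsto τ atTop (𝓝 0) := by
    have := hs.hasSum.tendsto_sum_nat.const_sub (∑' i, d i)
    rwa [sub_self] at this
  have hb0 : Tendsto (fun n : ℕ => 1 / (n : ℝ) ^ P) atTop (𝓝 0) := by
    have := tendsto_pow_div_pow (Nat.pos_of_ne_zero hP)
    simpa using this
  have hP' : (P : ℝ) ≠ 0 := by exact_mod_cast hP
  -- The tail is compared with 1 / n^P, whose differences are asymptotic to P / n^(P+1).
  have key := tendsto_div_of_tendsto_sub_div_sub (l := δ / P) hτ0 hb0 ?_ ?_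
  · refine key.congr fun n => ?_
    rw [div_div_eq_mul_div, div_one, mul_comm]
  · filter_upwards [eventually_ne_atTop 0] with n hn
    have : (0 : ℝ) < n := by exact_mod_cast Nat.pos_of_ne_zero hn
    push_cast
    apply one_div_lt_one_div_of_lt (by positivity)
    gcongr
    linarith
  · refine (hd.div (tendsto_mul_sub_inv_pow P) hP').congr' ?_
    filter_upwards [eventually_ne_atTop 0] with n hn
    have : (n : ℝ) ≠ 0 := by exact_mod_cast hn
    rw [hτd, Pi.div_apply, mul_div_mul_left _ _ (by positivity)]
    push_cast
    rfl

theorem eventually_const_of_eventually_succ_eq {u : ℕ → ℝ}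
    (h : ∀ᶠ n in atTop, u (n + 1) = u n) : ∃ c, ∀ᶠ n in atTop, u n = c := by
  obtain ⟨N, hN⟩ := eventually_atTop.1 h
  refine ⟨u N, eventually_atTop.2 ⟨N, fun n hn => ?_⟩⟩
  induction n, hn using Nat.le_induction with
  | base => rfl
  | succ n hn ih => rw [hN n hn, ih]

/-- The product `(m - x + 1) ⋯ (m + x + 1)`. -/
noncomputable def centralProd (x : ℕ) (m : ℝ) : ℝ :=
  ∏ i ∈ Finset.range (2 * x + 1), (m - x + 1 + i)

/-- Both sides are the same product of `2 * x + 2` consecutive factors, with the first or the last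
one split off. -/
theorem centralProd_add_one (x : ℕ) (m : ℝ) :
    (m + 1 - x) * centralProd x (m + 1) = (m + 2 + x) * centralProd x m := by
  have h1 := Finset.prod_range_succ (fun i : ℕ => m - x + 1 + i) (2 * x + 1)
  have h2 := Finset.prod_range_succ' (fun i : ℕ => m - x + 1 + i) (2 * x + 1)
  rw [h1] at h2
  push_cast at h2
  have e : ∀ i : ℕ, m - x + 1 + ((i : ℝ) + 1) = m + 1 - x + 1 + i := fun i => by ring
  simp only [e] at h2
  simp only [centralProd]
  linear_combination -h2

theorem tendsto_centralProd_div (x : ℕ) :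
    Tendsto (fun n : ℕ => centralProd x n / (n : ℝ) ^ (2 * x + 1)) atTop (𝓝 1) := by
  have h := tendsto_finsetProd (Finset.range (2 * x + 1))
    fun i _ => tendsto_add_div_natCast (-x + 1 + (i : ℝ))
  simp only [Finset.prod_const_one] at h
  refine h.congr fun n => ?_
  rw [Finset.prod_div_distrib, Finset.prod_const, Finset.card_range, centralProd]
  congr 1
  exact Finset.prod_congr rfl fun i _ => by ring

theorem eventually_centralProd_pos (x : ℕ) : ∀ᶠ n : ℕ in atTop, 0 < centralProd x n := by
  filter_upwards [eventually_ge_atTop x] with n hn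
  have : (x : ℝ) ≤ n := by exact_mod_cast hn
  exact Finset.prod_pos fun i _ => by
    have : (0 : ℝ) ≤ i := i.cast_nonneg
    linarith

theorem casoratian_succ {F : Type*} [Field F] {x y t k : F} {f g : ℕ → F} {n : ℕ}
    (hf : recur x y t k (n : F) (f n) (f (n + 1)) (f (n + 2)) = 0)
    (hg : recur x y t k (n : F) (g n) (g (n + 1)) (g (n + 2)) = 0) :
    ((n : F) + 2 + x) * (n + 2 + y) * (n + 2 + t) * casoratian f g (n + 1) =
      (n + 1 - x) * (n + 1 - y) * (n + 1 - t) * casoratian f g n := by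
  simp only [casoratian, recur] at *
  linear_combination f (n + 1) * hg - g (n + 1) * hf

theorem eventually_natCast_sub_pos (a : ℝ) : ∀ᶠ n : ℕ in atTop, 0 < (n : ℝ) - a := by
  filter_upwards [tendsto_natCast_atTop_atTop.eventually_gt_atTop a] with n hn
  linarith

theorem casoratian_eventually_eq {x y t : ℕ} {k : ℝ} {f g : ℕ → ℝ}
    (hf : IsSol (x : ℝ) y t k f) (hg : IsSol (x : ℝ) y t k g) :
    ∃ c, ∀ᶠ n : ℕ in atTop,
      casoratian f g n * (centralProd x n * centralProd y n * centralProd t n) = c := by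
  apply eventually_const_of_eventually_succ_eq
  filter_upwards [hf, hg, eventually_natCast_sub_pos x, eventually_natCast_sub_pos y,
    eventually_natCast_sub_pos t] with n h1 h2 nx ny nt
  have h := casoratian_succ h1 h2
  have ex := centralProd_add_one x n
  have ey := centralProd_add_one y n
  have et := centralProd_add_one t n
  have hne : ((n : ℝ) + 1 - x) * (n + 1 - y) * (n + 1 - t) ≠ 0 := by
    have : 0 < (n : ℝ) + 1 - x := by linarith
    have : 0 < (n : ℝ) + 1 - y := by linarith
    have : 0 < (n : ℝ) + 1 - t := by linarith
    positivity
  apply mul_left_cancel₀ hne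
  push_cast
  calc _ = casoratian f g (n + 1) * ((((n : ℝ) + 1 - x) * centralProd x (n + 1)) *
          (((n : ℝ) + 1 - y) * centralProd y (n + 1)) *
          (((n : ℝ) + 1 - t) * centralProd t (n + 1))) := by ring
    _ = (((n : ℝ) + 2 + x) * (n + 2 + y) * (n + 2 + t) * casoratian f g (n + 1)) *
          (centralProd x n * centralProd y n * centralProd t n) := by rw [ex, ey, et]; ring
    _ = _ := by rw [h]; ring

theorem isSol_domSol (x y t k : ℕ) : IsSol (x : ℝ) y t k (fun n => domSol x y t k n) :=
  Eventually.of_forall fun n => by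
    have := recur_domSol x.cast_nonneg y.cast_nonneg t.cast_nonneg k (n : ℝ)
    push_cast
    exact this

theorem domCoeff_natCast_ne_zero (x y t k : ℕ) : domCoeff (x : ℝ) y t k k ≠ 0 :=
  domCoeff_ne_zero x.cast_nonneg y.cast_nonneg t.cast_nonneg le_rfl

theorem eventually_domSol_ne_zero (x y t k : ℕ) :
    ∀ᶠ n : ℕ in atTop, domSol (x : ℝ) y t k n ≠ 0 := by
  filter_upwards [(tendsto_domSol_div x y t k).eventually_ne (domCoeff_natCast_ne_zero x y t k)]
    with n hn h
  simp [h] at hn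

/-- Every solution is eventually `Y (L + C τ)` for the polynomial solution `Y` and a fixed null
sequence `τ` of exact polynomial order. -/
theorem exists_tail (x y t k : ℕ) :
    ∃ (τ : ℕ → ℝ) (c : ℝ), c ≠ 0 ∧
      Tendsto (fun n : ℕ => (n : ℝ) ^ (2 * (x + y + t) + 4 * k + 2) * τ n) atTop (𝓝 c) ∧
      ∀ f, IsSol (x : ℝ) y t k f →
        ∃ L C, ∀ᶠ n : ℕ in atTop, f n = domSol x y t k n * (L + C * τ n) := by
  set Y : ℕ → ℝ := fun n => domSol x y t k n with hY
  set H : ℕ → ℝ := fun n => centralProd x n * centralProd y n * centralProd t n with hH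
  set c := domCoeff (x : ℝ) y t k k with hc
  have hc0 : c ≠ 0 := domCoeff_natCast_ne_zero x y t k
  have hYt : Tendsto (fun n : ℕ => Y n / (n : ℝ) ^ (2 * k)) atTop (𝓝 c) :=
    tendsto_domSol_div x y t k
  have hY1 : Tendsto (fun n : ℕ => Y (n + 1) / (n : ℝ) ^ (2 * k)) atTop (𝓝 c) := by
    have h := ((tendsto_add_atTop_iff_nat 1).2 hYt).mul ((tendsto_add_div_natCast 1).pow (2 * k))
    simp only [one_pow, mul_one] at h
    refine h.congr fun n => ?_
    have : (n : ℝ) + 1 ≠ 0 := by positivity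
    push_cast
    rw [div_pow]
    field_simp
  have hHt := ((tendsto_centralProd_div x).mul (tendsto_centralProd_div y)).mul
    (tendsto_centralProd_div t)
  -- `H` contributes degree 2(x + y + t) + 3, and each of the two values of `Y` contributes 2k.
  have hd : Tendsto (fun n : ℕ => (n : ℝ) ^ (2 * (x + y + t) + 4 * k + 2 + 1) *
      (H n * Y n * Y (n + 1))⁻¹) atTop (𝓝 (c * c)⁻¹) := by
    have h := ((hHt.mul hYt).mul hY1).inv₀ (by simp [hc0])
    simp only [mul_one, one_mul] at h
    refine h.congr' ?_
    filter_upwards [eventually_ne_atTop 0] with n hn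
    have : (n : ℝ) ≠ 0 := by exact_mod_cast hn
    have e : (n : ℝ) ^ (2 * (x + y + t) + 4 * k + 2 + 1) = (n : ℝ) ^ (2 * x + 1) *
      (n : ℝ) ^ (2 * y + 1) * (n : ℝ) ^ (2 * t + 1) * (n : ℝ) ^ (2 * k) * (n : ℝ) ^ (2 * k) := by
      ring
    rw [e]
    simp only [hH, div_eq_mul_inv, mul_inv, inv_inv]
    ring
  obtain ⟨τ, hτ, hτt⟩ := exists_tail_of_tendsto (by omega) hd
  refine ⟨τ, _, ?_, hτt, fun f hf => ?_⟩
  · have : ((2 * (x + y + t) + 4 * k + 2 : ℕ) : ℝ) ≠ 0 := by positivity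
    exact div_ne_zero (inv_ne_zero (mul_ne_zero hc0 hc0)) this
  obtain ⟨C, hC⟩ := casoratian_eventually_eq hf (isSol_domSol x y t k)
  have hY0 : ∀ᶠ n in atTop, Y n ≠ 0 := eventually_domSol_ne_zero x y t k
  have hY01 := (tendsto_add_atTop_nat 1).eventually hY0
  obtain ⟨L, hL⟩ := eventually_const_of_eventually_succ_eq (u := fun n => f n / Y n - C * τ n) (by
    filter_upwards [hC, hY0, hY01, eventually_centralProd_pos x, eventually_centralProd_pos y,
      eventually_centralProd_pos t] with n hn h0 h1 px py pt
    have hH0 : H n ≠ 0 := (mul_pos (mul_pos px py) pt).ne'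
    have hd := hτ n
    have hcas : f n * Y (n + 1) - f (n + 1) * Y n = C / H n := by
      rw [← hn]; exact (mul_div_cancel_right₀ _ hH0).symm
    -- Reduction of order: the difference of `f / Y` is the Casoratian over `Y n * Y (n + 1)`, so `f
    -- / Y` differs from `C * τ` by an eventual constant.
    have : f n / Y n - f (n + 1) / Y (n + 1) = C * (H n * Y n * Y (n + 1))⁻¹ := by
      rw [div_sub_div _ _ h0 h1, mul_comm (Y n) (f (n + 1)), hcas]
      field_simp
    rw [← hd] at this
    linarith)
  refine ⟨L, C, ?_⟩
  filter_upwards [hL, hY0] with n hn h0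
  have : f n / Y n = L + C * τ n := by linarith
  rw [← this]
  exact (mul_div_cancel₀ _ h0).symm

end Tails

/-! ### Solutions that tend to zero -/

section Null

theorem tendsto_zero_of_tendsto_pow_mul {f : ℕ → ℝ} {c : ℝ} {i j : ℕ} (hij : i < j)
    (h : Tendsto (fun n : ℕ => (n : ℝ) ^ j * f n) atTop (𝓝 c)) :
    Tendsto (fun n : ℕ => (n : ℝ) ^ i * f n) atTop (𝓝 0) := by
  have h := (tendsto_pow_div_pow hij).mul h
  rw [zero_mul] at h
  refine h.congr' ?_
  filter_upwards [eventually_ne_atTop 0] with n hn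
  have : (n : ℝ) ≠ 0 := by exact_mod_cast hn
  field_simp

theorem tendsto_div_pow_of_null {f : ℕ → ℝ} (h : Tendsto f atTop (𝓝 0)) (j : ℕ) :
    Tendsto (fun n : ℕ => f n / (n : ℝ) ^ j) atTop (𝓝 0) := by
  refine squeeze_zero_norm' (a := fun n => ‖f n‖) ?_ (by simpa using h.norm)
  filter_upwards [eventually_ge_atTop 1] with n hn
  have h1 : (1 : ℝ) ≤ (n : ℝ) ^ j := one_le_pow₀ (by exact_mod_cast hn)
  rw [norm_div, Real.norm_of_nonneg (r := (n : ℝ) ^ j) (by linarith)]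
  exact div_le_self (norm_nonneg _) h1

theorem tendsto_div_pow_of_expansion {x y t k : ℕ} {f τ : ℕ → ℝ} {L C : ℝ}
    (hτ : Tendsto τ atTop (𝓝 0))
    (h : ∀ᶠ n : ℕ in atTop, f n = domSol x y t k n * (L + C * τ n)) :
    Tendsto (fun n : ℕ => f n / (n : ℝ) ^ (2 * k)) atTop (𝓝 (domCoeff x y t k k * L)) := by
  have h1 := (tendsto_domSol_div x y t k).mul ((hτ.const_mul C).const_add L)
  rw [mul_zero, add_zero] at h1
  refine h1.congr' ?_
  filter_upwards [h] with n hn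
  rw [hn]; ring

/-- A solution that tends to zero is of the exact recessive order. -/
theorem IsSol.exists_tendsto_of_null {x y t k : ℕ} {f : ℕ → ℝ} (hf : IsSol (x : ℝ) y t k f)
    (h0 : Tendsto f atTop (𝓝 0)) :
    ∃ c, Tendsto (fun n : ℕ => (n : ℝ) ^ (2 * (x + y + t) + 2 * k + 2) * f n) atTop (𝓝 c) := by
  obtain ⟨τ, c, -, hτ, H⟩ := exists_tail x y t k
  obtain ⟨L, C, hLC⟩ := H f hf
  have hY := tendsto_domSol_div x y t k
  have hτ0 : Tendsto τ atTop (𝓝 0) := by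
    simpa using tendsto_zero_of_tendsto_pow_mul (i := 0) (by omega) hτ
  have hL : L = 0 := by
    have := tendsto_nhds_unique (tendsto_div_pow_of_expansion hτ0 hLC)
      (tendsto_div_pow_of_null h0 (2 * k))
    simpa [domCoeff_natCast_ne_zero x y t k] using this
  refine ⟨domCoeff x y t k k * (C * c), (hY.mul (hτ.const_mul C)).congr' ?_⟩
  filter_upwards [hLC, eventually_ne_atTop 0] with n hn h0
  have : (n : ℝ) ≠ 0 := by exact_mod_cast h0
  rw [hn, hL, show 2 * (x + y + t) + 4 * k + 2 = (2 * (x + y + t) + 2 * k + 2) + 2 * k by ring,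
    pow_add _ _ (2 * k)]
  field_simp
  ring

theorem IsSol.tendsto_pow_mul_of_null {x y t k j : ℕ} {f : ℕ → ℝ} (hf : IsSol (x : ℝ) y t k f)
    (h0 : Tendsto f atTop (𝓝 0)) (hj : j < 2 * (x + y + t) + 2 * k + 2) :
    Tendsto (fun n : ℕ => (n : ℝ) ^ j * f n) atTop (𝓝 0) := by
  obtain ⟨c, hc⟩ := hf.exists_tendsto_of_null h0
  exact tendsto_zero_of_tendsto_pow_mul hj hc

/-- The coefficients of `raise` grow linearly in `n`, so one spare power of `n` in the decay of `f`
suffices. -/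
theorem tendsto_raise_zero (x y t k : ℝ) {f : ℕ → ℝ}
    (hf : Tendsto (fun n : ℕ => (n : ℝ) * f n) atTop (𝓝 0)) :
    Tendsto (raise x y t k f) atTop (𝓝 0) := by
  have hx := tendsto_add_div_natCast (-x)
  have h1 := tendsto_add_div_natCast 1
  have hinv : Tendsto (fun n : ℕ => (1 : ℝ) / n) atTop (𝓝 0) :=
    tendsto_const_div_atTop_nhds_zero_nat 1
  have hf1 := (tendsto_add_atTop_iff_nat 1).2 hf
  have a := ((((tendsto_add_div_natCast (1 + y)).mul (tendsto_add_div_natCast (1 + t))).div hx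
    one_ne_zero).div h1 one_ne_zero).mul hf1
  have b := (((h1.add ((hinv.mul hinv).const_mul (midConst x y t k))).sub
    ((hx.mul hinv).const_mul (2 * k + 1 + 2 * x + y + t))).div hx one_ne_zero).mul hf
  have h := a.sub b
  simp only [mul_zero, sub_zero] at h
  refine h.congr' ?_
  filter_upwards [eventually_ne_atTop 0, eventually_natCast_sub_pos x] with n hn hx
  have : (n : ℝ) ≠ 0 := by exact_mod_cast hn
  have : (n : ℝ) - x ≠ 0 := hx.ne'
  have : (n : ℝ) + -x ≠ 0 := hx.ne'
  have : (n : ℝ) + 1 ≠ 0 := by positivity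
  simp only [raise, raiseNum, Pi.div_apply]
  push_cast
  rw [← sub_eq_add_neg]
  field_simp
  ring

end Null

/-! ### Rational approximating pairs for all parameters -/

section Reaches

/-- The pair of rational solutions `P`, `Q` is independent and `P / Q` approximates `ζ`. -/
structure ApproxPair (ζ : ℝ) (x y t k : ℚ) (P Q : ℕ → ℚ) : Prop where
  left : IsSol x y t k P
  right : IsSol x y t k Q
  indep : ∀ᶠ n in atTop, casoratian P Q n ≠ 0
  tendsto : Tendsto (fun n => (P n : ℝ) - ζ * Q n) atTop (𝓝 0)

theorem IsSol.ratCast {x y t k : ℕ} {f : ℕ → ℚ} (h : IsSol (x : ℚ) y t k f) :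
    IsSol (x : ℝ) y t k (fun n => (f n : ℝ)) := by
  have := h.map (Rat.castHom ℝ)
  simpa using this

theorem ApproxPair.tendsto_pow_mul {ζ : ℝ} {x y t k j : ℕ} {P Q : ℕ → ℚ}
    (h : ApproxPair ζ x y t k P Q) (hj : j < 2 * (x + y + t) + 2 * k + 2) :
    Tendsto (fun n : ℕ => (n : ℝ) ^ j * ((P n : ℝ) - ζ * Q n)) atTop (𝓝 0) :=
  (h.left.ratCast.sub_const_mul h.right.ratCast ζ).tendsto_pow_mul_of_null h.tendsto hj

theorem approxPair_raise {ζ : ℝ} {x y t k : ℚ} {P Q : ℕ → ℚ} (hP : IsSol x y t k P)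
    (hQ : IsSol x y t k Q) (hc : ∀ᶠ n in atTop, casoratian P Q n ≠ 0)
    (h0 : Tendsto (fun n : ℕ => (n : ℝ) * ((P n : ℝ) - ζ * Q n)) atTop (𝓝 0))
    (hk : (k + 1 + x) * (k + 1 + x + y) * (k + 1 + x + t) * (k + 1 + x + y + t) ≠ 0) :
    ApproxPair ζ (x + 1) y t k (raise x y t k P) (raise x y t k Q) := by
  have hx : ∀ᶠ n : ℕ in atTop, (n : ℚ) - x ≠ 0 := by
    filter_upwards [eventually_natCast_sub_pos x] with n hn h
    have : ((n : ℚ) : ℝ) - x = 0 := by exact_mod_cast h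
    simp only [Rat.cast_natCast] at this
    linarith
  refine ⟨isSol_raise hP hx, isSol_raise hQ hx, ?_, ?_⟩
  · filter_upwards [hP, hQ, hc, hx, (tendsto_add_atTop_nat 1).eventually hx] with n h1 h2 h3 h4 h5 h
    push_cast at h5
    have := casoratian_raise h1 h2 h4 h5
    rw [h, mul_zero] at this
    have h6 := mul_ne_zero (mul_ne_zero (show (-4 : ℚ) ≠ 0 by norm_num) hk) h3
    exact h6 (by rw [this]; ring)
  · refine (tendsto_raise_zero x y t k h0).congr fun n => ?_
    simp only [raise, raiseNum, midConst]
    push_cast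
    ring

/-- There is a pair of independent rational solutions whose quotient approximates `ζ`. -/
def Reaches (ζ : ℝ) (x y t k : ℕ) : Prop := ∃ P Q : ℕ → ℚ, ApproxPair ζ x y t k P Q

theorem Reaches.swap₁₂ {ζ : ℝ} {x y t k : ℕ} : Reaches ζ x y t k → Reaches ζ y x t k
  | ⟨P, Q, h⟩ => ⟨P, Q, h.left.swap₁₂, h.right.swap₁₂, h.indep, h.tendsto⟩

theorem Reaches.swap₁₃ {ζ : ℝ} {x y t k : ℕ} : Reaches ζ x y t k → Reaches ζ t y x k
  | ⟨P, Q, h⟩ => ⟨P, Q, h.left.swap₁₃, h.right.swap₁₃, h.indep, h.tendsto⟩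

theorem Reaches.succ_left {ζ : ℝ} {x y t k : ℕ} (h : Reaches ζ x y t k) :
    Reaches ζ (x + 1) y t k := by
  obtain ⟨P, Q, h⟩ := h
  refine ⟨raise x y t k P, raise x y t k Q, ?_⟩
  push_cast
  refine approxPair_raise h.left h.right h.indep ?_ (by positivity)
  simpa using h.tendsto_pow_mul (j := 1) (by omega)

/-- The route is (0, k) → (1, k) by `raise`, → (-1, k + 1) by reflection, → (0, k + 1) by `raise`.
Reflection costs two powers of `n` and the second `raise` one; at (1, k) a null solution is
O(n^-(2k+4)), so these three are available. -/
theorem Reaches.succ_right {ζ : ℝ} {k : ℕ} (h : Reaches ζ 0 0 0 k) : Reaches ζ 0 0 0 (k + 1) := by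
  obtain ⟨P, Q, h⟩ := h.succ_left
  have h3 := h.tendsto_pow_mul (j := 3) (by omega)
  have h2 := h.tendsto_pow_mul (j := 2) (by omega)
  obtain ⟨hP, hQ, hc, -⟩ := h
  norm_num at hP hQ
  have := approxPair_raise (ζ := ζ) hP.reflect hQ.reflect ?_ ?_ ?_
  · rw [neg_add_cancel] at this
    rw [Reaches]
    push_cast
    exact ⟨_, _, this⟩
  · filter_upwards [hc, eventually_ne_atTop 0] with n hn h0 h
    have : (n : ℚ) ≠ 0 := by exact_mod_cast h0
    refine mul_ne_zero (show (n : ℚ) * (n + 1) * ((n + 1) * (n + 2)) ≠ 0 by positivity) hn ?_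
    rw [← h]
    simp only [casoratian]
    push_cast
    ring
  · have := h3.add h2
    rw [add_zero] at this
    refine this.congr fun n => ?_
    push_cast
    ring
  · norm_num
    positivity

theorem reaches_zero : Reaches (∑' n : ℕ, 1 / (n : ℝ) ^ 3) 0 0 0 0 := by
  -- The term `i = 0` is `1 / 0 = 0`, both here and in the infinite sum.
  refine ⟨fun n => ∑ i ∈ Finset.range (n + 1), 1 / (i : ℚ) ^ 3, fun _ => 1, ?_, ?_, ?_, ?_⟩
  · refine Eventually.of_forall fun n => ?_
    simp only [Finset.sum_range_succ _ (n + 1 + 1), Finset.sum_range_succ _ (n + 1), recur,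
      midConst]
    push_cast
    field_simp
    ring
  · refine Eventually.of_forall fun n => ?_
    simp only [recur, midConst]
    push_cast
    ring
  · refine Eventually.of_forall fun n => ?_
    simp only [casoratian, Finset.sum_range_succ _ (n + 1)]
    have : (0 : ℚ) < 1 / ((n + 1 : ℕ) : ℚ) ^ 3 := by positivity
    intro h
    linarith
  · have hs := (Real.summable_one_div_nat_pow.2 (show 1 < 3 by norm_num)).hasSum.tendsto_sum_nat
    have := ((tendsto_add_atTop_iff_nat 1).2 hs).sub_const (∑' n : ℕ, 1 / (n : ℝ) ^ 3)
    rw [sub_self] at this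
    simpa using this

theorem reaches (x y t k : ℕ) : Reaches (∑' n : ℕ, 1 / (n : ℝ) ^ 3) x y t k := by
  have hk : Reaches (∑' n : ℕ, 1 / (n : ℝ) ^ 3) 0 0 0 k := by
    induction k with
    | zero => exact reaches_zero
    | succ k ih => exact ih.succ_right
  have hx : Reaches (∑' n : ℕ, 1 / (n : ℝ) ^ 3) x 0 0 k := by
    induction x with
    | zero => exact hk
    | succ x ih => exact ih.succ_left
  have hy : Reaches (∑' n : ℕ, 1 / (n : ℝ) ^ 3) x y 0 k := by
    induction y with
    | zero => exact hx
    | succ y ih => exact ih.swap₁₂.succ_left.swap₁₂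
  induction t with
  | zero => exact hy
  | succ t ih => exact ih.swap₁₃.succ_left.swap₁₃

end Reaches

/-! ### Quotients of independent solutions -/

section Expansion

theorem exists_expansion {x y t k : ℕ} {f g : ℕ → ℝ} (hf : IsSol (x : ℝ) y t k f)
    (hg : IsSol (x : ℝ) y t k g) (hc : ∀ᶠ n in atTop, casoratian f g n ≠ 0) :
    ∃ (τ : ℕ → ℝ) (c L₁ C₁ L₂ C₂ : ℝ), c ≠ 0 ∧
      Tendsto (fun n : ℕ => (n : ℝ) ^ (2 * (x + y + t) + 4 * k + 2) * τ n) atTop (𝓝 c) ∧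
      Tendsto τ atTop (𝓝 0) ∧
      (∀ᶠ n : ℕ in atTop, f n = domSol x y t k n * (L₁ + C₁ * τ n)) ∧
      (∀ᶠ n : ℕ in atTop, g n = domSol x y t k n * (L₂ + C₂ * τ n)) ∧
      L₁ * C₂ - C₁ * L₂ ≠ 0 := by
  obtain ⟨τ, c, c0, hτ, H⟩ := exists_tail x y t k
  obtain ⟨L₁, C₁, h₁⟩ := H f hf
  obtain ⟨L₂, C₂, h₂⟩ := H g hg
  refine ⟨τ, c, L₁, C₁, L₂, C₂, c0, hτ, ?_, h₁, h₂, fun hD => ?_⟩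
  · simpa using tendsto_zero_of_tendsto_pow_mul (i := 0) (by omega) hτ
  obtain ⟨n, hn, f0, f1, g0, g1⟩ := (hc.and (h₁.and (((tendsto_add_atTop_nat 1).eventually h₁).and
    (h₂.and ((tendsto_add_atTop_nat 1).eventually h₂))))).exists
  apply hn
  rw [casoratian, f0, f1, g0, g1]
  -- The Casoratian of the two expansions is this product times the determinant `L₁ * C₂ - C₁ * L₂`.
  linear_combination domSol (x : ℝ) y t k n * domSol (x : ℝ) y t k ↑(n + 1) *
    (τ (n + 1) - τ n) * hD

/-- If `f - ζ g` tends to zero then `f / g` is defined eventually and tends to `ζ`. -/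
theorem tendsto_div_of_null {x y t k : ℕ} {f g : ℕ → ℝ} {ζ : ℝ} (hf : IsSol (x : ℝ) y t k f)
    (hg : IsSol (x : ℝ) y t k g) (hc : ∀ᶠ n in atTop, casoratian f g n ≠ 0)
    (h0 : Tendsto (fun n => f n - ζ * g n) atTop (𝓝 0)) :
    (∀ᶠ n in atTop, g n ≠ 0) ∧ Tendsto (fun n => f n / g n) atTop (𝓝 ζ) := by
  obtain ⟨τ, c, L₁, C₁, L₂, C₂, -, -, hτ, h₁, h₂, hD⟩ := exists_expansion hf hg hc
  have hd := domCoeff_natCast_ne_zero x y t k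
  have hf' := tendsto_div_pow_of_expansion hτ h₁
  have hg' := tendsto_div_pow_of_expansion hτ h₂
  have hn := tendsto_div_pow_of_null h0 (2 * k)
  have hL : L₁ = ζ * L₂ := by
    have := tendsto_nhds_unique ((hf'.sub (hg'.const_mul ζ)).congr fun n => by ring) hn
    apply mul_left_cancel₀ hd
    linear_combination this
  have hL₂ : L₂ ≠ 0 := by
    rintro rfl
    simp [hL] at hD
  have hg0 : ∀ᶠ n in atTop, g n ≠ 0 := by
    filter_upwards [hg'.eventually_ne (mul_ne_zero hd hL₂)] with n h h'
    simp [h'] at h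
  refine ⟨hg0, ?_⟩
  have h := (hn.div hg' (mul_ne_zero hd hL₂)).add_const ζ
  rw [zero_div, zero_add] at h
  refine h.congr' ?_
  filter_upwards [hg0, eventually_ne_atTop 0] with n hgn hn
  have : (n : ℝ) ≠ 0 := by exact_mod_cast hn
  simp only [Pi.div_apply]
  field_simp
  ring

/-- The exact order of the error of a convergent quotient of two solutions. -/
theorem exists_tendsto_pow_mul_sub_div {x y t k : ℕ} {f g : ℕ → ℝ} {ζ : ℝ}
    (hf : IsSol (x : ℝ) y t k f) (hg : IsSol (x : ℝ) y t k g)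
    (hc : ∀ᶠ n in atTop, casoratian f g n ≠ 0) (hg0 : ∀ᶠ n in atTop, g n ≠ 0)
    (h : Tendsto (fun n => f n / g n) atTop (𝓝 ζ)) :
    ∃ c ≠ 0, Tendsto (fun n : ℕ => (n : ℝ) ^ (2 * (x + y + t) + 4 * k + 2) * (ζ - f n / g n))
      atTop (𝓝 c) := by
  obtain ⟨τ, c, L₁, C₁, L₂, C₂, c0, hτP, hτ, h₁, h₂, hD⟩ := exists_expansion hf hg hc
  have hY := eventually_domSol_ne_zero x y t k
  have e₁ : Tendsto (fun n => L₁ + C₁ * τ n) atTop (𝓝 L₁) := by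
    simpa using (hτ.const_mul C₁).const_add L₁
  have e₂ : Tendsto (fun n => L₂ + C₂ * τ n) atTop (𝓝 L₂) := by
    simpa using (hτ.const_mul C₂).const_add L₂
  have hL : L₁ = ζ * L₂ := by
    refine tendsto_nhds_unique e₁ ((h.mul e₂).congr' ?_)
    filter_upwards [hY, hg0, h₁, h₂] with n hn hgn a₁ a₂
    rw [a₂] at hgn
    rw [a₁, a₂, mul_div_mul_left _ _ hn, div_mul_cancel₀ _ (right_ne_zero_of_mul hgn)]
  have hL₂ : L₂ ≠ 0 := by
    rintro rfl
    simp [hL] at hD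
  -- With `L₁ = ζ * L₂` the error is `(ζ * C₂ - C₁) * τ / (L₂ + C₂ * τ)`, and `L₂ * (ζ * C₂ - C₁)`
  -- is the nonzero determinant.
  refine ⟨(ζ * C₂ - C₁) * c / L₂, ?_, ?_⟩
  · refine div_ne_zero (mul_ne_zero (fun h0 => hD ?_) c0) hL₂
    rw [hL]
    linear_combination L₂ * h0
  · refine ((hτP.const_mul (ζ * C₂ - C₁)).div e₂ hL₂).congr' ?_
    filter_upwards [hY, hg0, h₁, h₂] with n hn hgn a₁ a₂
    rw [a₂] at hgn
    have := right_ne_zero_of_mul hgn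
    rw [a₁, a₂, mul_div_mul_left _ _ hn, hL]
    simp only [Pi.div_apply]
    field_simp
    ring

end Expansion

/-! ### Continued fractions with prescribed numerators and denominators -/

section ContinuedFractions

theorem ratCF_nums_add_two (a b : ℕ → ℚ) (n : ℕ) : (ratCF a b).nums (n + 2) =
    a (n + 2) * (ratCF a b).nums (n + 1) + b (n + 1) * (ratCF a b).nums n :=
  GenContFract.nums_recurrence (ratCF_get? a b (n + 1)) rfl rfl

theorem ratCF_dens_add_two (a b : ℕ → ℚ) (n : ℕ) : (ratCF a b).dens (n + 2) =
    a (n + 2) * (ratCF a b).dens (n + 1) + b (n + 1) * (ratCF a b).dens n :=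
  GenContFract.dens_recurrence (ratCF_get? a b (n + 1)) rfl rfl

theorem casoratian_ratCF_ne_zero {a b : ℕ → ℚ} (hb : ∀ n, b n ≠ 0) (n : ℕ) :
    casoratian (ratCF a b).nums (ratCF a b).dens n ≠ 0 := by
  induction n with
  | zero =>
    have h := ratCF_get? a b 0
    simp only [casoratian]
    rw [zero_add, GenContFract.first_num_eq h, GenContFract.first_den_eq h,
      GenContFract.zeroth_num_eq_h, GenContFract.zeroth_den_eq_one]
    intro h0
    exact hb 0 (by linear_combination -h0)
  | succ n ih =>
    have : casoratian (ratCF a b).nums (ratCF a b).dens (n + 1) =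
        -b (n + 1) * casoratian (ratCF a b).nums (ratCF a b).dens n := by
      simp only [casoratian, ratCF_nums_add_two, ratCF_dens_add_two]
      ring
    rw [this]
    exact mul_ne_zero (neg_ne_zero.2 (hb _)) ih

/-- Every pair of sequences with nonvanishing Casoratian and `q 0 = 1` consists of the numerators
and denominators of a continued fraction. -/
theorem exists_ratCF {p q : ℕ → ℚ} (hq : q 0 = 1) (hc : ∀ n, casoratian p q n ≠ 0) :
    ∃ a b : ℕ → ℚ, (∀ n, b n ≠ 0) ∧ (ratCF a b).nums = p ∧ (ratCF a b).dens = q ∧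
      ∀ n α β, p (n + 2) = α * p (n + 1) + β * p n → q (n + 2) = α * q (n + 1) + β * q n →
        a (n + 2) = α ∧ b (n + 1) = β := by
  -- From index 2 of `a` and index 1 of `b` on, the values are Cramer's solution of the two
  -- three-term recurrences; the earlier ones match `p 0`, `p 1`, `q 1`.
  set a : ℕ → ℚ := fun n => match n with
    | 0 => p 0
    | 1 => q 1
    | n + 2 => (p n * q (n + 2) - p (n + 2) * q n) / casoratian p q n with ha
  set b : ℕ → ℚ := fun n => match n with
    | 0 => p 1 - q 1 * p 0
    | n + 1 => -casoratian p q (n + 1) / casoratian p q n with hb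
  have key : ∀ n, ((ratCF a b).nums n = p n ∧ (ratCF a b).dens n = q n) ∧
      ((ratCF a b).nums (n + 1) = p (n + 1) ∧ (ratCF a b).dens (n + 1) = q (n + 1)) := by
    intro n
    induction n with
    | zero =>
      have h := ratCF_get? a b 0
      refine ⟨⟨rfl, hq.symm⟩, ?_, ?_⟩
      · rw [GenContFract.first_num_eq h]
        simp only [ha, hb, ratCF]
        ring
      · rw [GenContFract.first_den_eq h]
    | succ n ih =>
      refine ⟨ih.2, ?_, ?_⟩
      · rw [ratCF_nums_add_two, ih.1.1, ih.2.1]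
        have := hc n
        simp only [ha, hb]
        field_simp
        simp only [casoratian]
        ring
      · rw [ratCF_dens_add_two, ih.1.2, ih.2.2]
        have := hc n
        simp only [ha, hb]
        field_simp
        simp only [casoratian]
        ring
  refine ⟨a, b, fun n => ?_, funext fun n => (key n).1.1, funext fun n => (key n).1.2,
    fun n α β h1 h2 => ⟨?_, ?_⟩⟩
  · cases n with
    | zero =>
      intro h
      refine hc 0 ?_
      simp only [hb] at h
      simp only [casoratian, hq]
      linear_combination -h
    | succ n => exact div_ne_zero (neg_ne_zero.2 (hc _)) (hc _)
  · simp only [ha]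
    rw [div_eq_iff (hc n), h1, h2]
    simp only [casoratian]
    ring
  · simp only [hb]
    rw [div_eq_iff (hc n)]
    simp only [casoratian, h1, h2]
    ring

/-- Any two sequences with eventually nonvanishing Casoratian and convergent quotient eventually
are the numerators and denominators of a continued fraction. -/
theorem exists_ratCF_eventually {p q : ℕ → ℚ} {ζ : ℝ}
    (hc : ∀ᶠ n in atTop, casoratian p q n ≠ 0) (hq : ∀ᶠ n in atTop, q n ≠ 0)
    (h : Tendsto (fun n => (p n : ℝ) / q n) atTop (𝓝 ζ)) :
    ∃ a b : ℕ → ℚ, (∀ n, b n ≠ 0) ∧ (∀ᶠ n in atTop, (ratCF a b).nums n = p n) ∧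
      (∀ᶠ n in atTop, (ratCF a b).dens n = q n) ∧
      ∀ᶠ n in atTop, ∀ α β, p (n + 2) = α * p (n + 1) + β * p n →
        q (n + 2) = α * q (n + 1) + β * q n → a (n + 2) = α ∧ b (n + 1) = β := by
  have ht := (h.add_atTop tendsto_natCast_atTop_atTop).eventually_gt_atTop 1
  obtain ⟨N, hN⟩ := eventually_atTop.1 (hc.and (hq.and ht))
  -- No `b n` may vanish, so the initial segment is replaced by `-n` and `1`, with Casoratian 1. At
  -- the junction the Casoratian vanishes only if `p / q = -N` at `N + 1`, which `p / q + n > 1`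
  -- excludes.
  obtain ⟨a, b, hb, hp', hq', huniq⟩ := exists_ratCF
    (p := fun n => if n ≤ N then -n else p n) (q := fun n => if n ≤ N then 1 else q n) (by simp) (by
      intro n
      rcases lt_trichotomy n N with hn | hn | hn
      · simp [casoratian, hn.le, Nat.succ_le_of_lt hn]
      · obtain ⟨-, h1, h2⟩ := hN (N + 1) (by omega)
        subst hn
        simp only [casoratian, le_refl, if_true, Nat.not_succ_le_self, if_false, mul_one]
        intro h0
        have h3 : p (n + 1) = -n * q (n + 1) := by linear_combination -h0
        have h4 : ((q (n + 1) : ℚ) : ℝ) ≠ 0 := by exact_mod_cast h1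
        rw [h3] at h2
        push_cast at h2
        rw [mul_div_cancel_right₀ _ h4] at h2
        linarith
      · have h1 : ¬ n ≤ N := by omega
        have h2 : ¬ n + 1 ≤ N := by omega
        simpa [casoratian, h1, h2] using (hN n hn.le).1)
  refine ⟨a, b, hb, ?_, ?_, ?_⟩
  · filter_upwards [eventually_gt_atTop N] with n hn
    exact (congrFun hp' n).trans (if_neg (by omega))
  · filter_upwards [eventually_gt_atTop N] with n hn
    exact (congrFun hq' n).trans (if_neg (by omega))
  · filter_upwards [eventually_gt_atTop N] with n hn α β h1 h2
    refine huniq n α β ?_ ?_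
    · rwa [if_neg (by omega), if_neg (by omega), if_neg (by omega)]
    · rwa [if_neg (by omega), if_neg (by omega), if_neg (by omega)]

end ContinuedFractions

/-! ### The four-parameter family -/

section Family

/-- The factor that relates the recurrence of the family to the normalized one. -/
def gaugeProd (u v w n : ℕ) : ℚ :=
  ∏ j ∈ Finset.range n, (((j : ℚ) + 1 + (u + v + w) + w) * (j + 1 + (u + v + w) + (v + w)) *
    (j + 1 + (u + v + w) + (u + v + w)))

theorem gaugeProd_pos (u v w n : ℕ) : 0 < gaugeProd u v w n :=
  Finset.prod_pos fun j _ => by positivity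

theorem gaugeProd_succ (u v w n : ℕ) : gaugeProd u v w (n + 1) = gaugeProd u v w n *
    (((n : ℚ) + 1 + (u + v + w) + w) * (n + 1 + (u + v + w) + (v + w)) *
      (n + 1 + (u + v + w) + (u + v + w))) :=
  Finset.prod_range_succ _ _

/-- The six factors of `familyB` at `n + 1` split in half: three are the trailing coefficient of
`recur` at the shifted index, and the other three are the ratio of consecutive values of
`gaugeProd`. -/
theorem gaugeProd_mul_recur (u v w k n : ℕ) (f₀ f₁ f₂ : ℚ) :
    gaugeProd u v w (n + 2) * f₂ - (familyA u v w k).eval ((n + 2 : ℕ) : ℚ) * (gaugeProd u v w (n + 1) * f₁)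
        - (familyB u v w).eval ((n + 1 : ℕ) : ℚ) * (gaugeProd u v w n * f₀) =
      gaugeProd u v w (n + 1) * recur (w : ℚ) ((v + w : ℕ) : ℚ) ((u + v + w : ℕ) : ℚ) k
        ((n + (u + v + w) : ℕ) : ℚ) f₀ f₁ f₂ := by
  simp only [gaugeProd_succ, familyA, familyB, recur, midConst, eval_mul, eval_add, eval_neg, eval_X,
    eval_C, eval_pow, eval_ofNat]
  push_cast
  ring

/-- Normalization of a solution of the recurrence of the family. -/
def normalized (u v w : ℕ) (p : ℕ → ℚ) (m : ℕ) : ℚ :=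
  p (m - (u + v + w)) / gaugeProd u v w (m - (u + v + w))

theorem normalized_add (u v w : ℕ) (p : ℕ → ℚ) (n : ℕ) :
    normalized u v w p (n + (u + v + w)) = p n / gaugeProd u v w n := by
  rw [normalized, Nat.add_sub_cancel]

theorem gaugeProd_mul_normalized (u v w : ℕ) (p : ℕ → ℚ) (n : ℕ) :
    gaugeProd u v w n * normalized u v w p (n + (u + v + w)) = p n := by
  rw [normalized_add, mul_div_cancel₀ _ (gaugeProd_pos u v w n).ne']

theorem eventually_of_eventually_add {P : ℕ → Prop} (s : ℕ)
    (h : ∀ᶠ n in atTop, P (n + s)) : ∀ᶠ n in atTop, P n := by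
  obtain ⟨N, hN⟩ := eventually_atTop.1 h
  filter_upwards [eventually_ge_atTop (N + s)] with n hn
  obtain ⟨m, rfl⟩ := Nat.exists_eq_add_of_le' (le_trans (Nat.le_add_left s N) hn)
  exact hN m (by omega)

theorem isSol_normalized {u v w k : ℕ} {p : ℕ → ℚ}
    (h : ∀ᶠ n : ℕ in atTop, p (n + 2) = (familyA u v w k).eval ((n + 2 : ℕ) : ℚ) * p (n + 1) +
      (familyB u v w).eval ((n + 1 : ℕ) : ℚ) * p n) :
    IsSol (w : ℚ) ((v + w : ℕ) : ℚ) ((u + v + w : ℕ) : ℚ) k (normalized u v w p) := by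
  refine eventually_of_eventually_add (u + v + w) ?_
  filter_upwards [h] with n hn
  have e1 : n + (u + v + w) + 1 = n + 1 + (u + v + w) := by ring
  have e2 : n + (u + v + w) + 2 = n + 2 + (u + v + w) := by ring
  apply mul_left_cancel₀ (gaugeProd_pos u v w (n + 1)).ne'
  rw [← gaugeProd_mul_recur, e1, e2, gaugeProd_mul_normalized, gaugeProd_mul_normalized, gaugeProd_mul_normalized,
    hn]
  ring

theorem IsSol.gaugeProd_mul {u v w k : ℕ} {f : ℕ → ℚ}
    (h : IsSol (w : ℚ) ((v + w : ℕ) : ℚ) ((u + v + w : ℕ) : ℚ) k f) :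
    ∀ᶠ n : ℕ in atTop, gaugeProd u v w (n + 2) * f (n + 2 + (u + v + w)) =
      (familyA u v w k).eval ((n + 2 : ℕ) : ℚ) * (gaugeProd u v w (n + 1) * f (n + 1 + (u + v + w))) +
      (familyB u v w).eval ((n + 1 : ℕ) : ℚ) * (gaugeProd u v w n * f (n + (u + v + w))) := by
  filter_upwards [(tendsto_add_atTop_nat (u + v + w)).eventually h] with n hn
  have e1 : n + (u + v + w) + 1 = n + 1 + (u + v + w) := by ring
  have e2 : n + (u + v + w) + 2 = n + 2 + (u + v + w) := by ring
  rw [e1, e2] at hn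
  have := gaugeProd_mul_recur u v w k n (f (n + (u + v + w))) (f (n + 1 + (u + v + w)))
    (f (n + 2 + (u + v + w)))
  rw [hn, mul_zero] at this
  linear_combination this

theorem casoratian_ratCast (f g : ℕ → ℚ) (n : ℕ) :
    casoratian (fun n => (f n : ℝ)) (fun n => (g n : ℝ)) n = (casoratian f g n : ℚ) := by
  simp [casoratian]

theorem eventually_eval_familyA_ne_zero (u v w k : ℕ) :
    ∀ᶠ n : ℕ in atTop, (familyA u v w k).eval (n : ℚ) ≠ 0 := by
  filter_upwards [eventually_ge_atTop 1] with n hn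
  obtain ⟨m, rfl⟩ := Nat.exists_eq_add_of_le' hn
  simp only [familyA, eval_mul, eval_add, eval_X, eval_C, eval_pow, eval_ofNat]
  push_cast
  refine ne_of_gt (mul_pos ?_ ?_)
  · have : (0 : ℚ) < 2 * m + 1 + 2 * (u + v + w) := by positivity
    linarith
  · have : (0 : ℚ) < (m ^ 2 + m + 2 * (u + v + w) * m + 2 * (u + v + w)) + (u ^ 2 + 2 * v ^ 2 +
      4 * w ^ 2 + 3 * u * v + 4 * u * w + 6 * v * w + v + 2 * w + 1
      + 2 * k * (u + 2 * v + 3 * w) + 2 * k ^ 2 + 2 * k) := by positivity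
    linarith

theorem riemannZeta_three :
    riemannZeta 3 = ((∑' n : ℕ, 1 / (n : ℝ) ^ 3 : ℝ) : ℂ) := by
  have := zeta_nat_eq_tsum_of_gt_one (show 1 < 3 by norm_num)
  push_cast at this ⊢
  exact this

theorem ratCF_convs_cast (a b : ℕ → ℚ) (n : ℕ) : (((ratCF a b).convs n : ℚ) : ℂ) =
    ((((ratCF a b).nums n : ℝ) / ((ratCF a b).dens n : ℝ) : ℝ) : ℂ) := by
  rw [GenContFract.conv_eq_num_div_den]
  push_cast
  rfl

theorem represents_zeta_three (u v w k : ℕ) :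
    Represents (familyA u v w k) (familyB u v w) (riemannZeta 3) := by
  obtain ⟨P, Q, h⟩ := reaches w (v + w) (u + v + w) k
  set s := u + v + w with hs
  set p : ℕ → ℚ := fun n => gaugeProd u v w n * P (n + s) with hp
  set q : ℕ → ℚ := fun n => gaugeProd u v w n * Q (n + s) with hq
  have hc : ∀ᶠ n in atTop, casoratian p q n ≠ 0 := by
    filter_upwards [(tendsto_add_atTop_nat s).eventually h.indep] with n hn h0
    have := mul_ne_zero (mul_pos (gaugeProd_pos u v w n) (gaugeProd_pos u v w (n + 1))).ne' hn
    apply this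
    rw [← h0]
    simp only [casoratian, hp, hq]
    rw [show n + s + 1 = n + 1 + s by ring]
    ring
  obtain ⟨hQ0, hlim⟩ := tendsto_div_of_null h.left.ratCast h.right.ratCast
    (by
      filter_upwards [h.indep] with n hn
      rw [casoratian_ratCast]
      exact_mod_cast hn) h.tendsto
  have hq0 : ∀ᶠ n in atTop, q n ≠ 0 := by
    filter_upwards [(tendsto_add_atTop_nat s).eventually hQ0] with n hn
    exact mul_ne_zero (gaugeProd_pos u v w n).ne' (by exact_mod_cast hn)
  have hpq : Tendsto (fun n => (p n : ℝ) / q n) atTop (𝓝 (∑' n : ℕ, 1 / (n : ℝ) ^ 3)) := by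
    refine ((tendsto_add_atTop_iff_nat s).2 hlim).congr fun n => ?_
    have : ((gaugeProd u v w n : ℚ) : ℝ) ≠ 0 := by exact_mod_cast (gaugeProd_pos u v w n).ne'
    simp only [hp, hq]
    push_cast
    rw [mul_div_mul_left _ _ this]
  obtain ⟨a, b, hb, hnum, hden, hab⟩ := exists_ratCF_eventually hc hq0 hpq
  have hab' : ∀ᶠ n : ℕ in atTop, a (n + 2) = (familyA u v w k).eval ((n + 2 : ℕ) : ℚ) ∧
      b (n + 1) = (familyB u v w).eval ((n + 1 : ℕ) : ℚ) := by
    filter_upwards [hab, h.left.gaugeProd_mul, h.right.gaugeProd_mul] with n hn h1 h2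
    exact hn _ _ h1 h2
  have ha : ∀ᶠ n : ℕ in atTop, a n = (familyA u v w k).eval (n : ℚ) :=
    eventually_of_eventually_add 2 (hab'.mono fun n h => h.1)
  refine ⟨a, b, ⟨hb, ?_, ha, eventually_of_eventually_add 1 (hab'.mono fun n h => h.2)⟩, ?_, ?_⟩
  · filter_upwards [ha, eventually_eval_familyA_ne_zero u v w k] with n h1 h2
    rwa [h1]
  · filter_upwards [hden, hq0] with n h1 h2
    rwa [h1]
  · rw [riemannZeta_three]
    refine ((Complex.continuous_ofReal.tendsto _).comp hpq).congr' ?_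
    filter_upwards [hnum, hden] with n h1 h2
    rw [ratCF_convs_cast, h1, h2]
    rfl

theorem hasSpeed_of_convergesTo {u v w k : ℕ} {a b : ℕ → ℚ} {ζ : ℝ}
    (h : HasPolynomialTail a b (familyA u v w k) (familyB u v w)) (hc : CFConvergesTo a b ζ) :
    CFHasSpeed a b ζ (2 * u + 4 * v + 6 * w + 4 * k + 2) := by
  set s := u + v + w with hs
  set p : ℕ → ℚ := (ratCF a b).nums with hp
  set q : ℕ → ℚ := (ratCF a b).dens with hq
  have ha := (tendsto_add_atTop_nat 2).eventually h.a_eq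
  have hb := (tendsto_add_atTop_nat 1).eventually h.b_eq
  have hf : IsSol (w : ℚ) ((v + w : ℕ) : ℚ) ((u + v + w : ℕ) : ℚ) k (normalized u v w p) := by
    refine isSol_normalized ?_
    filter_upwards [ha, hb] with n h1 h2
    rw [← h1, ← h2]
    exact ratCF_nums_add_two a b n
  have hg : IsSol (w : ℚ) ((v + w : ℕ) : ℚ) ((u + v + w : ℕ) : ℚ) k (normalized u v w q) := by
    refine isSol_normalized ?_
    filter_upwards [ha, hb] with n h1 h2
    rw [← h1, ← h2]
    exact ratCF_dens_add_two a b n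
  have hcas : ∀ᶠ n in atTop, casoratian (fun n => (normalized u v w p n : ℝ))
      (fun n => (normalized u v w q n : ℝ)) n ≠ 0 := by
    refine eventually_of_eventually_add s (Eventually.of_forall fun n h0 => ?_)
    rw [casoratian_ratCast] at h0
    have h0 : casoratian (normalized u v w p) (normalized u v w q) (n + s) = 0 := by
      exact_mod_cast h0
    refine casoratian_ratCF_ne_zero (a := a) h.b_ne_zero n ?_
    simp only [casoratian, ← hp, ← hq] at h0 ⊢
    rw [show n + s + 1 = n + 1 + s by ring] at h0
    rw [← gaugeProd_mul_normalized u v w p n, ← gaugeProd_mul_normalized u v w p (n + 1),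
      ← gaugeProd_mul_normalized u v w q n, ← gaugeProd_mul_normalized u v w q (n + 1)]
    linear_combination gaugeProd u v w n * gaugeProd u v w (n + 1) * h0
  have hg0 : ∀ᶠ n in atTop, (normalized u v w q n : ℝ) ≠ 0 := by
    refine eventually_of_eventually_add s (hc.1.mono fun n hn => ?_)
    rw [normalized_add]
    exact_mod_cast div_ne_zero hn (gaugeProd_pos u v w n).ne'
  have hquot : ∀ n, (normalized u v w p (n + s) : ℝ) / normalized u v w q (n + s) = p n / q n := by
    intro n
    have : ((gaugeProd u v w n : ℚ) : ℝ) ≠ 0 := by exact_mod_cast (gaugeProd_pos u v w n).ne'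
    rw [normalized_add, normalized_add]
    push_cast
    rw [div_div_div_cancel_right₀ this]
  have hlim : Tendsto (fun n => (normalized u v w p n : ℝ) / normalized u v w q n) atTop
      (𝓝 ζ) := by
    rw [← tendsto_add_atTop_iff_nat s]
    simp only [hquot]
    have h2 := (Complex.continuous_re.tendsto _).comp hc.2
    refine h2.congr fun n => ?_
    rw [Function.comp_apply, ratCF_convs_cast, Complex.ofReal_re]
  obtain ⟨c, c0, hcl⟩ := exists_tendsto_pow_mul_sub_div hf.ratCast hg.ratCast hcas hg0 hlim
  refine ⟨c, by exact_mod_cast c0, ?_⟩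
  have hP : 2 * (w + (v + w) + (u + v + w)) + 4 * k + 2 = 2 * u + 4 * v + 6 * w + 4 * k + 2 := by
    ring
  rw [hP] at hcl
  set D := 2 * u + 4 * v + 6 * w + 4 * k + 2
  have hreal : Tendsto (fun n : ℕ => (n : ℝ) ^ D * (ζ - p n / q n)) atTop (𝓝 c) := by
    -- Undoing the index shift replaces `(n + s) ^ D` by `n ^ D`, whose ratio tends to 1.
    have h1 := ((tendsto_add_atTop_iff_nat s).2 hcl).div
      ((tendsto_add_div_natCast s).pow D) (by simp)
    simp only [one_pow, div_one] at h1
    refine h1.congr' ?_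
    filter_upwards [eventually_ne_atTop 0] with n hn
    have : (n : ℝ) ≠ 0 := by exact_mod_cast hn
    have : (n : ℝ) + s ≠ 0 := by positivity
    rw [Pi.div_apply, hquot]
    push_cast
    rw [div_pow]
    field_simp
  refine ((Complex.continuous_ofReal.tendsto _).comp hreal).congr fun n => ?_
  rw [Function.comp_apply, ratCF_convs_cast]
  push_cast
  rfl

end Family

theorem mainTheorem2 (u v w k : ℕ) :
    Represents (familyA u v w k) (familyB u v w) (riemannZeta 3) ∧
      ∀ a b : ℕ → ℚ, HasPolynomialTail a b (familyA u v w k) (familyB u v w) →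
        CFConvergesTo a b (riemannZeta 3) →
          CFHasSpeed a b (riemannZeta 3) (2 * u + 4 * v + 6 * w + 4 * k + 2) := by
  refine ⟨represents_zeta_three u v w k, fun a b h hc => ?_⟩
  rw [riemannZeta_three] at hc ⊢
  exact hasSpeed_of_convergesTo h hc
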